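/- For a group $H$ let $C_\bullet(H)\to\mathbb Z$ be the standard resolution, $C_n(H)=\mathbb Z[H^{n+1}]$ with the diagonal action of $H$ and $\partial(h_0,\dots,h_n)=\sum_i(-1)^i(h_0,\dots,\widehat{h_i},\dots,h_n)$. Let $G$ be a group, $G'\le G$ a subgroup, $N$ a $G$-module and $N'\subseteq N$ a $G'$-submodule. Define the relative homology $$H_n(G,G';N,N'):=H_n\big((C_\bullet(G)\otimes_G N)/(C_\bullet(G')\otimes_{G'}N')\big),$$ where the quotient is the cokernel of the map $C_\bullet(G')\otimes_{G'}N'\to C_\bullet(G)\otimes_G N$ induced by the two inclusions. **Proposition.** Let $G'$ be a subgroup of a group $G$. Let $\cdots\to L_1\to L_0\to M\to 0$ be an exact complex of $G$-modules, and let $\cdots\to L'_1\to L'_0\to M'\to 0$ be an exact complex of $G'$-modules that is a $G'$-subcomplex of it, so that $L'_p\subseteq L_p$ for all $p\ge 0$ and $M'\subseteq M$ are $G'$-submodules and all maps of the second complex are restrictions of those of the first. Then there is a first-quadrant homological spectral sequence, with differentials $d^r\colon E^r_{p,q}\to E^r_{p-r,q+r-1}$ for $r\ge 1$, such that $$E^1_{p,q}\cong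 H_q(G,G';L_p,L'_p)\ \Longrightarrow\ H_{p+q}(G,G';M,M'),$$ where $d^1\colon E^1_{p+1,q}\to E^1_{p,q}$ corresponds to the map induced by the differentials $L_{p+1}\to L_p$ and $L'_{p+1}\to L'_p$. Convergence means that every $H_n(G,G';M,M')$ has a filtration $0=F_{-1}\subseteq F_0\subseteq\dots\subseteq F_n=H_n(G,G';M,M')$ by subgroups with $F_p/F_{p-1}\cong E^\infty_{p,n-p}$ for $0\le p\le n$, where $E^\infty_{p,q}$ is the common value of $E^r_{p,q}$ for $r\ge p+q+2$. -/

import Mathlib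

open CategoryTheory

universe u v w

noncomputable section

namespace RelativeGroupHomology

/-! ### The standard resolution and the complexes `C_•(G) ⊗_G M`

The coefficient ring is a commutative ring `k`; a `G`-module is the case `k = ℤ`. -/

/-- The simplicial `G`-module with `n`-simplices the free module `k[G^{n+1}]` on the
`(n+1)`-tuples of elements of `G`, with the diagonal left action of `G`. Its `i`-th face map omits
the `i`-th entry of a tuple. -/
def standardSimplicial (k : Type) [CommRing k] (G : Type u) [Group G] :
    SimplicialObject (Rep.{u} k G) where
  obj n := Rep.of (Representation.ofMulAction k G (Fin (n.unop.len + 1) → G))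
  map f := Rep.ofHom
    { toLinearMap := MonoidAlgebra.mapDomainLinearMap k k fun x => x ∘ f.unop.toOrderHom
      isIntertwining' := fun g => by
        refine MonoidAlgebra.lhom_ext' fun x => LinearMap.ext fun r => ?_
        simp
        rfl }
  map_id n := by
    ext x
    simp
  map_comp f g := by
    ext x
    simp [Function.comp_assoc]

/-- The standard resolution `C_•(G) → k` (without its augmentation): `C_n(G) = k[G^{n+1}]` and
`∂(g_0, …, g_n) = ∑ i, (-1)^i (g_0, …, g_{i-1}, g_{i+1}, …, g_n)`. -/
def standardResolution (k : Type) [CommRing k] (G : Type u) [Group G] :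
    ChainComplex (Rep.{u} k G) ℕ :=
  (AlgebraicTopology.alternatingFaceMapComplex (Rep.{u} k G)).obj (standardSimplicial k G)

variable {k : Type} [CommRing k]

/-- The functor `P ↦ P ⊗_G M`, where `P ⊗_G M` is the quotient of `P ⊗ M` by the relations
`g p ⊗ g m = p ⊗ m`; a left module `P` is turned into a right one by `p g = g⁻¹ p`. -/
def tensorOver {G : Type u} [Group G] (M : Rep.{v} k G) : Rep.{u} k G ⥤ ModuleCat.{max u v} k where
  obj P := ModuleCat.of k (P.ρ.tprod M.ρ).Coinvariants
  map {P Q} f := ModuleCat.ofHom <| Representation.Coinvariants.map (P.ρ.tprod M.ρ) (Q.ρ.tprod M.ρ)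
    { toLinearMap := TensorProduct.map f.hom.toLinearMap LinearMap.id
      isIntertwining' := fun g => by
        ext x m
        simp [Representation.IntertwiningMap.isIntertwining] }
  map_id P := by
    ext x m
    simp
  map_comp f g := by
    ext x m
    simp

instance {G : Type u} [Group G] (M : Rep.{v} k G) : (tensorOver M).Additive where
  map_add {P Q f g} := by
    refine ModuleCat.hom_ext (Representation.Coinvariants.hom_ext (TensorProduct.ext' fun x m => ?_))
    change Representation.Coinvariants.mk _ ((f + g).hom x ⊗ₜ[k] m) =
      Representation.Coinvariants.mk _ (f.hom x ⊗ₜ[k] m) +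
        Representation.Coinvariants.mk _ (g.hom x ⊗ₜ[k] m)
    rw [← map_add, ← TensorProduct.add_tmul]
    rfl

/-- The complex `C_•(G) ⊗_G M`. -/
def chains {G : Type u} [Group G] (M : Rep.{v} k G) : ChainComplex (ModuleCat.{max u v} k) ℕ :=
  ((tensorOver M).mapHomologicalComplex _).obj (standardResolution k G)

lemma chains_d {G : Type u} [Group G] (M : Rep.{v} k G) (n : ℕ) :
    (chains M).d (n + 1) n =
      ∑ i : Fin (n + 2), (-1 : ℤ) ^ (i : ℕ) • (tensorOver M).map ((standardSimplicial k G).δ i) := by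
  simp [chains, standardResolution, AlgebraicTopology.AlternatingFaceMapComplex.objD,
    Functor.map_sum]
  rfl

/-! ### Morphisms of pairs -/

lemma comp_sum_zsmul_eq {C : Type*} [Category C] [Preadditive C] {X X' Y Y' : C} {n : ℕ}
    (c : Fin n → ℤ) (φ : X' ⟶ X) (ψ : Y' ⟶ Y) (a : Fin n → (X ⟶ Y)) (b : Fin n → (X' ⟶ Y'))
    (h : ∀ i, φ ≫ a i = b i ≫ ψ) : φ ≫ ∑ i, c i • a i = (∑ i, c i • b i) ≫ ψ := by
  simp [Preadditive.comp_sum, Preadditive.sum_comp, h]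

section Pairs

variable {G' G : Type u} [Group G'] [Group G] {M' : Rep.{v} k G'} {M : Rep.{v} k G}

/-- The map `k[G'^{n+1}] ⊗_{G'} M' → k[G^{n+1}] ⊗_G M` sending `(g_0, …, g_n) ⊗ m` to
`(f g_0, …, f g_n) ⊗ σ m`. -/
def chainsMapAux (f : G' →* G) (σ : M' ⟶ Rep.res f M) (n : ℕ) :
    ((Representation.ofMulAction k G' (Fin (n + 1) → G')).tprod M'.ρ).Coinvariants →ₗ[k]
      ((Representation.ofMulAction k G (Fin (n + 1) → G)).tprod M.ρ).Coinvariants :=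
  Representation.Coinvariants.lift _
    (Representation.Coinvariants.mk _ ∘ₗ
      TensorProduct.map (MonoidAlgebra.mapDomainLinearMap k k fun x => f ∘ x) σ.hom.toLinearMap)
    (fun g => by
      ext x m
      have h1 := Representation.Coinvariants.mk_self_apply
        ((Representation.ofMulAction k G (Fin (n + 1) → G)).tprod M.ρ) (f g)
        (MonoidAlgebra.single (f ∘ x) 1 ⊗ₜ[k] σ.hom m)
      have h2 := Rep.hom_comm_apply σ g m
      have h3 : f ∘ (g • x) = f g • (f ∘ x) := by
        ext i
        simp
      simp at h1 h2 ⊢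
      rw [h2, h3, ← h1])

/-- A morphism of pairs `(f, σ) : (G', M') → (G, M)`, where `σ (g' m') = f(g') σ(m')`, induces
the chain map `f_• ⊗ σ : C_•(G') ⊗_{G'} M' → C_•(G) ⊗_G M`. -/
def chainsMap (f : G' →* G) (σ : M' ⟶ Rep.res f M) : chains M' ⟶ chains M where
  f n := ModuleCat.ofHom (chainsMapAux f σ n)
  comm' i j hij := by
    obtain rfl : j + 1 = i := hij
    rw [chains_d, chains_d]
    refine comp_sum_zsmul_eq _ _ _ _ _ fun i => ?_
    refine ModuleCat.hom_ext (Representation.Coinvariants.hom_ext (TensorProduct.ext ?_))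
    refine MonoidAlgebra.lhom_ext' fun x => LinearMap.ext fun r => LinearMap.ext fun m => ?_
    have h : ∀ (H : Type u) [Group H] (y : Fin (j + 2) → H),
      ((standardSimplicial k H).δ i).hom (MonoidAlgebra.single y r) =
        MonoidAlgebra.single (y ∘ i.succAbove) r := fun H _ y =>
      MonoidAlgebra.mapDomain_single
    change Representation.Coinvariants.mk _ (((standardSimplicial k G).δ i).hom
        (MonoidAlgebra.mapDomain (fun x => f ∘ x) (MonoidAlgebra.single x r)) ⊗ₜ[k] σ.hom m) =
      Representation.Coinvariants.mk _ (MonoidAlgebra.mapDomain (fun x => f ∘ x)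
        (((standardSimplicial k G').δ i).hom (MonoidAlgebra.single x r)) ⊗ₜ[k] σ.hom m)
    rw [h]
    simp only [MonoidAlgebra.mapDomain_single]
    rw [h]
    rfl

end Pairs

/-! ### Relative homology -/

section Relative

variable {G' G : Type u} [Group G'] [Group G]

/-- The quotient complex `C_•(G) ⊗_G M / C_•(G') ⊗_{G'} M'` of a morphism of pairs. -/
def relChains {M' : Rep.{v} k G'} {M : Rep.{v} k G} (f : G' →* G) (σ : M' ⟶ Rep.res f M) :
    ChainComplex (ModuleCat.{max u v} k) ℕ :=
  Limits.cokernel (chainsMap f σ)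

/-- The relative homology `H_n(G, G'; M, M')` of a morphism of pairs `(f, σ) : (G', M') → (G, M)`;
it is used for `f` and `σ` injective. -/
def relHomology {M' : Rep.{v} k G'} {M : Rep.{v} k G} (f : G' →* G) (σ : M' ⟶ Rep.res f M)
    (n : ℕ) : ModuleCat.{max u v} k :=
  (relChains f σ).homology n

/-- The map `C_•(G) ⊗_G M₁ → C_•(G) ⊗_G M₂` induced by a morphism of `G`-modules. -/
abbrev chainsCoeffMap {M₁ M₂ : Rep.{v} k G} (a : M₁ ⟶ M₂) : chains M₁ ⟶ chains M₂ :=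
  chainsMap (MonoidHom.id G) a

lemma chainsMap_comm {M₁' M₂' : Rep.{v} k G'} {M₁ M₂ : Rep.{v} k G} {f : G' →* G}
    {σ₁ : M₁' ⟶ Rep.res f M₁} {σ₂ : M₂' ⟶ Rep.res f M₂} (a' : M₁' ⟶ M₂') (a : M₁ ⟶ M₂)
    (h : σ₁ ≫ (Rep.resFunctor f).map a = a' ≫ σ₂) :
    chainsMap f σ₁ ≫ chainsCoeffMap a = chainsCoeffMap a' ≫ chainsMap f σ₂ := by
  refine HomologicalComplex.hom_ext _ _ fun n => ?_
  refine ModuleCat.hom_ext (Representation.Coinvariants.hom_ext (TensorProduct.ext ?_))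
  refine MonoidAlgebra.lhom_ext' fun x => LinearMap.ext fun r => LinearMap.ext fun m => ?_
  have h' : a.hom (σ₁.hom m) = σ₂.hom (a'.hom m) := congr((Rep.Hom.hom $h) m)
  change Representation.Coinvariants.mk _
      (MonoidAlgebra.mapDomain (fun x => MonoidHom.id G ∘ x)
        (MonoidAlgebra.mapDomain (fun x => f ∘ x) (MonoidAlgebra.single x r)) ⊗ₜ[k]
          a.hom (σ₁.hom m)) =
    Representation.Coinvariants.mk _
      (MonoidAlgebra.mapDomain (fun x => f ∘ x)
        (MonoidAlgebra.mapDomain (fun x => MonoidHom.id G' ∘ x) (MonoidAlgebra.single x r)) ⊗ₜ[k]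
          σ₂.hom (a'.hom m))
  rw [h']
  simp only [MonoidAlgebra.mapDomain_single]
  rfl

/-- The map `H_n(G, G'; M₁, M₁') → H_n(G, G'; M₂, M₂')` induced by a `G`-morphism `a : M₁ → M₂`
and a `G'`-morphism `a' : M₁' → M₂'` that are compatible with `σ₁` and `σ₂`. -/
def relHomologyMap {M₁' M₂' : Rep.{v} k G'} {M₁ M₂ : Rep.{v} k G} {f : G' →* G}
    {σ₁ : M₁' ⟶ Rep.res f M₁} {σ₂ : M₂' ⟶ Rep.res f M₂} (a' : M₁' ⟶ M₂') (a : M₁ ⟶ M₂)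
    (h : σ₁ ≫ (Rep.resFunctor f).map a = a' ≫ σ₂) (n : ℕ) :
    relHomology f σ₁ n ⟶ relHomology f σ₂ n :=
  HomologicalComplex.homologyMap
    (Limits.cokernel.map (chainsMap f σ₁) (chainsMap f σ₂) (chainsCoeffMap a') (chainsCoeffMap a)
      (chainsMap_comm a' a h)) n

end Relative

/-! ### Exact complexes over a module -/

/-- The complex of `G`-modules `⋯ → L_2 → L_1 → L_0 → M → 0` is exact. -/
structure IsExactOver {G : Type u} [Group G] (L : ChainComplex (Rep.{v} k G) ℕ) {M : Rep.{v} k G}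
    (ε : L.X 0 ⟶ M) : Prop where
  exact_succ (p : ℕ) : Function.Exact (L.d (p + 2) (p + 1)).hom (L.d (p + 1) p).hom
  exact_zero : Function.Exact (L.d 1 0).hom ε.hom
  surjective : Function.Surjective ε.hom

/-! ### First-quadrant homological spectral sequences -/

/-- Homological spectral sequences starting at the page `E¹` whose terms `E^r_{p,q}` are indexed by
`p, q ≥ 0`; the differential of the page `E^r` is `d^r : E^r_{p,q} → E^r_{p-r,q+r-1}`. -/
abbrev FirstQuadrantSpectralSequence (k : Type) [CommRing k] :=
  SpectralSequence (ModuleCat.{w} k)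
    (fun r : ℤ => ComplexShape.spectralSequenceNat ((-r, r - 1) : ℤ × ℤ)) 1

namespace FirstQuadrantSpectralSequence

/-- The first page `E^1`, with its differential `d^1`. -/
abbrev firstPage (E : FirstQuadrantSpectralSequence.{w} k) :
    HomologicalComplex (ModuleCat.{w} k)
      (ComplexShape.spectralSequenceNat ((-1, 1 - 1) : ℤ × ℤ)) :=
  E.page 1 le_rfl

/-- The limit term `E^∞_{p,q}`. For `r ≥ p + q + 2` the differentials from and to `E^r_{p,q}` vanish
since they leave the first quadrant, so that `E^r_{p,q}` is independent of such `r`. -/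
def infinity (E : FirstQuadrantSpectralSequence.{w} k) (p q : ℕ) : ModuleCat.{w} k :=
  (E.page (p + q + 2)).X (p, q)

/-- Convergence `E^1_{p,q} ⇒ H_{p+q}`: each `H_n` has a filtration
`0 = F_{-1} ⊆ F_0 ⊆ ⋯ ⊆ F_n = H_n` by submodules such that `F_p / F_{p-1} ≅ E^∞_{p,n-p}` for
`0 ≤ p ≤ n`. -/
def ConvergesTo (E : FirstQuadrantSpectralSequence.{w} k) (H : ℕ → ModuleCat.{w} k) : Prop :=
  ∀ n : ℕ, ∃ F : ℤ → Submodule k (H n), Monotone F ∧ F (-1) = ⊥ ∧ F n = ⊤ ∧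
    ∀ p q : ℕ, p + q = n →
      Nonempty ((F p ⧸ (F (p - 1)).submoduleOf (F p)) ≃ₗ[k] E.infinity p q)

end FirstQuadrantSpectralSequence

end RelativeGroupHomology

end

noncomputable section

/-! ### Exact couples in the first quadrant -/

/-! Normalising the first entry of a tuple to `1` identifies `C_n(G) ⊗_G M` with a direct sum of
copies of `M` indexed by `G^n` (`coinvariantsEquivFinsupp`). It is therefore exact in `M`
(`chainsMapAux_id_exact`), and an injective morphism of pairs induces an injection
(`chainsMapAux_injective`). So the exact complex obtained from `L' → M'` is degreewise a subcomplex
of the exact complex obtained from `L → M`, and the quotient is exact as well: the relative chain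
complexes `P_p` of `(L_p, L'_p)` resolve the relative chain complex `Q` of `(M, M')`
(`relChainsResolution`).

This resolution is cut into short exact sequences `0 → Z_{p+1} → P_p → Z_p → 0` with `Z_0 = Q`.
Their long exact homology sequences form an exact couple with `A_{p,q} = H_q(Z_p)` and `E_{p,q} =
H_q(P_p)`. All pages are written down at once as subquotients of `E_{p,q}`, without iterating
derived couples: `E^{s+1} = β⁻¹(im δ^s) / α(ker δ^s)`, where the differential sends `x` with `β x =
δ^s y` to the class of `α y`. For `s = 0` this is `α β`, the map induced by `P_{p+1} → P_p`. The
homology of a page is the next page by `pageD_mkQ_eq_zero_iff` and `mkQ_mem_range_pageD_iff`.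

The limit `H_n(Q) = A_{0,n}` is filtered by `F_p = ker δ^{p+1}`. The map `δ^p` takes `F_p` onto `im
δ^p ∩ ker δ = im δ^p ∩ im β` with kernel `F_{p-1}`, and `β` identifies `E^∞_{p,n-p}` with the same
module (`map_β_pageCycles`). -/

/-- A first-quadrant homological exact couple of modules: long exact sequences
`⋯ → A_{p+1,q} → E_{p,q} → A_{p,q} → A_{p+1,q-1} → ⋯ → E_{p,0} → A_{p,0} → 0` for all `p`. -/
structure ExactCouple (R : Type u) [CommRing R] where
  /-- The terms of the couple from which the filtration arises. -/
  A : ℕ → ℕ → ModuleCat.{w} R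
  /-- The terms of the first page. -/
  E : ℕ → ℕ → ModuleCat.{w} R
  /-- The map `A_{p+1,q} → E_{p,q}`. -/
  α (p q : ℕ) : A (p + 1) q →ₗ[R] E p q
  /-- The map `E_{p,q} → A_{p,q}`. -/
  β (p q : ℕ) : E p q →ₗ[R] A p q
  /-- The connecting map `A_{p,q+1} → A_{p+1,q}`. -/
  δ (p q q' : ℕ) (h : q' + 1 = q) : A p q →ₗ[R] A (p + 1) q'
  exact_α_β (p q : ℕ) : Function.Exact (α p q) (β p q)
  exact_β_δ (p q q' : ℕ) (h : q' + 1 = q) : Function.Exact (β p q) (δ p q q' h)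
  exact_δ_α (p q q' : ℕ) (h : q' + 1 = q) : Function.Exact (δ p q q' h) (α p q')
  surjective_β (p : ℕ) : Function.Surjective (β p 0)

namespace ExactCouple

variable {R : Type u} [CommRing R] (C : ExactCouple.{u, w} R)

lemma β_α (p q : ℕ) (y : C.A (p + 1) q) : C.β p q (C.α p q y) = 0 :=
  (C.exact_α_β p q).apply_apply_eq_zero y

/-! ### Iterated connecting maps, their images and kernels -/

/-- The iterated connecting map `δ^s : A_{p,q} → A_{p+s,q-s}`. -/
def δIter : ∀ (s p q p' q' : ℕ), p + s = p' → q' + s = q → (C.A p q →ₗ[R] C.A p' q')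
  | 0, _, _, _, _, rfl, rfl => LinearMap.id
  | s + 1, p, q, p', q', hp, hq =>
    δIter s (p + 1) (q' + s) p' q' (by omega) rfl ∘ₗ C.δ p q (q' + s) hq

lemma δIter_succ (s p q p' q' q₁ : ℕ) (hp : p + (s + 1) = p') (hq : q' + (s + 1) = q)
    (hp₁ : p + 1 + s = p') (hq₁ : q' + s = q₁) (hq₂ : q₁ + 1 = q) :
    C.δIter (s + 1) p q p' q' hp hq =
      C.δIter s (p + 1) q₁ p' q' hp₁ hq₁ ∘ₗ C.δ p q q₁ hq₂ := by
  subst hq₁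
  rfl

/-- The definition splits off the first `δ`, which suits kernels; images are pushed forward along
the last `δ`, so both decompositions are needed. -/
lemma δIter_succ_left (s p q p' q' : ℕ) (hp : p + s = p') (hq : q' + (s + 1) = q)
    (hp₁ : p + (s + 1) = p' + 1) (hq₁ : q' + 1 + s = q) :
    C.δIter (s + 1) p q (p' + 1) q' hp₁ hq =
      C.δ p' (q' + 1) q' rfl ∘ₗ C.δIter s p q p' (q' + 1) hp hq₁ := by
  induction s generalizing p q with
  | zero => subst hp hq; rfl
  | succ s ih =>
    rw [C.δIter_succ (s + 1) p q (p' + 1) q' (q' + (s + 1)) hp₁ hq (by omega) rfl (by omega),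
      ih (p + 1) (q' + (s + 1)) (by omega) rfl (by omega) (by omega),
      C.δIter_succ s p q p' (q' + 1) (q' + (s + 1)) hp hq₁ (by omega) (by omega) (by omega),
      LinearMap.comp_assoc]

/-- The image of `δ^s` in `A_{p,q}`, where `A_{p,q}` is extended to `p < 0` by isomorphisms
`δ : A_{p,q} → A_{p+1,q-1}`. -/
def imageFiltration : ∀ _ p q : ℕ, Submodule R (C.A p q)
  | 0, _, _ => ⊤
  | _ + 1, 0, _ => ⊤
  | s + 1, p + 1, q => (imageFiltration s p (q + 1)).map (C.δ p (q + 1) q rfl)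

/-- The kernel of `δ^s` on `A_{p,q}`, where `A_{p,q}` is extended to `q < 0` by zero. -/
def kernelFiltration : ∀ _ p q : ℕ, Submodule R (C.A p q)
  | 0, _, _ => ⊥
  | _ + 1, _, 0 => ⊤
  | s + 1, p, q + 1 => (kernelFiltration s (p + 1) q).comap (C.δ p (q + 1) q rfl)

lemma imageFiltration_eq_range (s p q p' q' : ℕ) (hp : p + s = p') (hq : q' + s = q) :
    C.imageFiltration s p' q' = LinearMap.range (C.δIter s p q p' q' hp hq) := by
  induction s generalizing p' q' with
  | zero => subst hp hq; exact LinearMap.range_id.symm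
  | succ s ih =>
    obtain rfl : p' = p + s + 1 := by omega
    rw [C.δIter_succ_left s p q (p + s) q' rfl hq hp (by omega), LinearMap.range_comp,
      ← ih (p + s) (q' + 1) rfl (by omega)]
    rfl

lemma kernelFiltration_eq_ker (s p q p' q' : ℕ) (hp : p + s = p') (hq : q' + s = q) :
    C.kernelFiltration s p q = LinearMap.ker (C.δIter s p q p' q' hp hq) := by
  induction s generalizing p q with
  | zero => subst hp hq; exact LinearMap.ker_id.symm
  | succ s ih =>
    obtain rfl : q = q' + s + 1 := by omega
    rw [C.δIter_succ s p _ p' q' (q' + s) hp hq (by omega) rfl rfl, LinearMap.ker_comp,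
      ← ih (p + 1) (q' + s) (by omega) rfl]
    rfl

lemma imageFiltration_succ_le (s p q : ℕ) :
    C.imageFiltration (s + 1) p q ≤ C.imageFiltration s p q := by
  induction s generalizing p q with
  | zero => exact le_top
  | succ s ih =>
    cases p with
    | zero => exact le_rfl
    | succ p => exact Submodule.map_mono (ih p (q + 1))

lemma kernelFiltration_le_succ (s p q : ℕ) :
    C.kernelFiltration s p q ≤ C.kernelFiltration (s + 1) p q := by
  induction s generalizing p q with
  | zero => exact bot_le
  | succ s ih =>
    cases q with
    | zero => exact le_rfl
    | succ q => exact Submodule.comap_mono (ih (p + 1) q)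

/-- After `p` steps back the recursion reaches `A_{0,p+q}`, and further steps count as isomorphisms.
-/
lemma imageFiltration_succ_eq (s p q : ℕ) (h : p ≤ s) :
    C.imageFiltration (s + 1) p q = C.imageFiltration s p q := by
  induction s generalizing p q with
  | zero =>
    obtain rfl : p = 0 := by omega
    rfl
  | succ s ih =>
    cases p with
    | zero => rfl
    | succ p => exact congrArg (Submodule.map _) (ih p (q + 1) (by omega))

lemma kernelFiltration_eq_top (s p q : ℕ) (h : q < s) : C.kernelFiltration s p q = ⊤ := by
  induction s generalizing p q with
  | zero => omega
  | succ s ih =>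
    cases q with
    | zero => rfl
    | succ q =>
      rw [kernelFiltration, ih (p + 1) q (by omega), Submodule.comap_top]

/-- The submodule of `E_{p,q}` of elements that survive to the page `s + 1`. -/
def pageCycles (s p q : ℕ) : Submodule R (C.E p q) :=
  (C.imageFiltration s p q).comap (C.β p q)

/-- The submodule of `E_{p,q}` of elements that vanish on the page `s + 1`. -/
def pageBoundaries (s p q : ℕ) : Submodule R (C.E p q) :=
  (C.kernelFiltration s (p + 1) q).map (C.α p q)

lemma mem_pageCycles_iff {s p q : ℕ} {x : C.E p q} :
    x ∈ C.pageCycles s p q ↔ C.β p q x ∈ C.imageFiltration s p q := Iff.rfl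

lemma pageCycles_succ_eq (s p q : ℕ) (h : p ≤ s) :
    C.pageCycles (s + 1) p q = C.pageCycles s p q :=
  congrArg (Submodule.comap _) (C.imageFiltration_succ_eq s p q h)

/-- `δ^s` leaves the quadrant, so its kernel is everything and the boundaries are all of `im α = ker
β`. -/
lemma pageBoundaries_eq_ker (s p q : ℕ) (h : q < s) :
    C.pageBoundaries s p q = LinearMap.ker (C.β p q) := by
  rw [pageBoundaries, C.kernelFiltration_eq_top _ _ _ h, Submodule.map_top]
  exact ((C.exact_α_β p q).linearMap_ker_eq).symm

lemma pageCycles_succ_le (s p q : ℕ) : C.pageCycles (s + 1) p q ≤ C.pageCycles s p q :=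
  Submodule.comap_mono (C.imageFiltration_succ_le s p q)

lemma pageBoundaries_le_succ (s p q : ℕ) :
    C.pageBoundaries s p q ≤ C.pageBoundaries (s + 1) p q :=
  Submodule.map_mono (C.kernelFiltration_le_succ s (p + 1) q)

lemma α_mem_pageCycles (s p q : ℕ) (y : C.A (p + 1) q) : C.α p q y ∈ C.pageCycles s p q := by
  simp [pageCycles, β_α]

lemma β_eq_zero_of_mem_pageBoundaries {s p q : ℕ} {x : C.E p q}
    (hx : x ∈ C.pageBoundaries s p q) : C.β p q x = 0 := by
  obtain ⟨y, -, rfl⟩ := hx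
  exact C.β_α p q y

/-- The term `E^{s+1}_{p,q}`. -/
abbrev pageX (s p q : ℕ) : Type w :=
  C.pageCycles s p q ⧸ (C.pageBoundaries s p q).submoduleOf (C.pageCycles s p q)

/-- The map `A_{p+1,q} → E^{s+1}_{p,q}` induced by `α`. -/
def toPage (s p q : ℕ) : C.A (p + 1) q →ₗ[R] C.pageX s p q :=
  Submodule.mkQ _ ∘ₗ (C.α p q).codRestrict _ (C.α_mem_pageCycles s p q)

lemma toPage_eq_zero_iff (s p q : ℕ) (y : C.A (p + 1) q) :
    C.toPage s p q y = 0 ↔ C.α p q y ∈ C.pageBoundaries s p q := by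
  rw [toPage, LinearMap.comp_apply, Submodule.mkQ_apply, Submodule.Quotient.mk_eq_zero]
  rfl

/-! ### The differential of a page, its kernel and its image -/

section Differential

variable (s p q p' q' : ℕ) (hp : p' + 1 + s = p) (hq : q + s = q')

/-- Makes the class of `α y` independent of the choice of `y` with `δ^s y = β x`. -/
lemma ker_δIter_le_ker_toPage :
    LinearMap.ker (C.δIter s (p' + 1) q' p q hp hq) ≤ LinearMap.ker (C.toPage s p' q') := by
  intro y hy
  rw [← C.kernelFiltration_eq_ker] at hy
  exact (C.toPage_eq_zero_iff s p' q' y).2 ⟨y, hy, rfl⟩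

/-- The map on the cycles in `E_{p,q}` sending `x` with `β x = δ^s y` to the class of `α y`. -/
def pageCyclesD : C.pageCycles s p q →ₗ[R] C.pageX s p' q' :=
  Submodule.liftQ _ (C.toPage s p' q') (C.ker_δIter_le_ker_toPage s p q p' q' hp hq) ∘ₗ
    (C.δIter s (p' + 1) q' p q hp hq).quotKerEquivRange.symm.toLinearMap ∘ₗ
      (C.β p q).restrict fun x hx => by
        rwa [← C.imageFiltration_eq_range]

lemma pageCyclesD_eq (x : C.pageCycles s p q) (y : C.A (p' + 1) q')
    (h : C.δIter s (p' + 1) q' p q hp hq y = C.β p q x) :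
    C.pageCyclesD s p q p' q' hp hq x = C.toPage s p' q' y := by
  have h' : (C.β p q).restrict (p := C.pageCycles s p q) (q := LinearMap.range
      (C.δIter s (p' + 1) q' p q hp hq)) (fun x hx => by
        rwa [← C.imageFiltration_eq_range]) x = ⟨_, LinearMap.mem_range_self _ y⟩ :=
    Subtype.ext h.symm
  simp only [pageCyclesD, LinearMap.comp_apply, h', LinearEquiv.coe_coe]
  rw [LinearMap.quotKerEquivRange_symm_apply_image]
  rfl

lemma exists_δIter_eq (x : C.pageCycles s p q) :
    ∃ y, C.δIter s (p' + 1) q' p q hp hq y = C.β p q x := by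
  have h : C.β p q x ∈ C.imageFiltration s p q := x.2
  rwa [C.imageFiltration_eq_range s (p' + 1) q' p q hp hq] at h

/-- The differential `d^{s+1} : E^{s+1}_{p,q} → E^{s+1}_{p-s-1,q+s}`. -/
def pageD : C.pageX s p q →ₗ[R] C.pageX s p' q' :=
  Submodule.liftQ _ (C.pageCyclesD s p q p' q' hp hq) fun x hx => by
    rw [LinearMap.mem_ker, C.pageCyclesD_eq s p q p' q' hp hq x 0, map_zero]
    exact (map_zero _).trans (C.β_eq_zero_of_mem_pageBoundaries hx).symm

lemma pageD_mkQ (x : C.pageCycles s p q) (y : C.A (p' + 1) q')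
    (h : C.δIter s (p' + 1) q' p q hp hq y = C.β p q x) :
    C.pageD s p q p' q' hp hq (Submodule.mkQ _ x) = C.toPage s p' q' y :=
  C.pageCyclesD_eq s p q p' q' hp hq x y h

/-- With `β x = δ^s y`, the class of `α y` vanishes iff `y ∈ ker δ^s + ker α`. Since `ker α = im δ`,
this says that `δ^s y ∈ im δ^{s+1}`. -/
lemma pageD_mkQ_eq_zero_iff (x : C.pageCycles s p q) :
    C.pageD s p q p' q' hp hq (Submodule.mkQ _ x) = 0 ↔
      (x : C.E p q) ∈ C.pageCycles (s + 1) p q := by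
  obtain ⟨y, hy⟩ := C.exists_δIter_eq s p q p' q' hp hq x
  rw [C.pageD_mkQ s p q p' q' hp hq x y hy, toPage_eq_zero_iff, pageBoundaries, pageCycles,
    Submodule.mem_comap, C.imageFiltration_eq_range (s + 1) p' (q' + 1) p q (by omega) (by omega),
    C.δIter_succ s p' (q' + 1) p q q' (by omega) (by omega) hp hq rfl,
    C.kernelFiltration_eq_ker s _ _ p q hp hq]
  constructor
  · rintro ⟨z, hz, hzy⟩
    obtain ⟨t, ht⟩ := (C.exact_δ_α p' (q' + 1) q' rfl (y - z)).1 (by rw [map_sub, hzy, sub_self])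
    refine ⟨t, ?_⟩
    rw [LinearMap.comp_apply, ht, map_sub, hy, (LinearMap.mem_ker.1 hz :), sub_zero]
  · rintro ⟨t, ht⟩
    refine ⟨y - C.δ p' (q' + 1) q' rfl t, ?_, ?_⟩
    · rw [SetLike.mem_coe, LinearMap.mem_ker, map_sub, hy, ← ht]
      exact sub_self _
    · rw [map_sub, (C.exact_δ_α p' (q' + 1) q' rfl).apply_apply_eq_zero, sub_zero]

/-- The image consists of the classes of `α y` with `δ^s y ∈ im β = ker δ`, that is, with `y ∈ ker
δ^{s+1}`. -/
lemma mkQ_mem_range_pageD_iff (x : C.pageCycles s p' q') :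
    Submodule.mkQ _ x ∈ LinearMap.range (C.pageD s p q p' q' hp hq) ↔
      (x : C.E p' q') ∈ C.pageBoundaries (s + 1) p' q' := by
  have key (y : C.A (p' + 1) q') : y ∈ C.kernelFiltration (s + 1) (p' + 1) q' ↔
      C.δIter s (p' + 1) q' p q hp hq y ∈ LinearMap.range (C.β p q) := by
    -- No `δ` starts at `A_{p,0}`; there surjectivity of `β` replaces exactness.
    cases q with
    | zero =>
      rw [C.kernelFiltration_eq_top _ _ _ (by omega),
        LinearMap.range_eq_top.2 (C.surjective_β p)]
      simp
    | succ q =>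
      rw [C.kernelFiltration_eq_ker (s + 1) (p' + 1) q' (p + 1) q (by omega) (by omega),
        C.δIter_succ_left s (p' + 1) q' p q hp (by omega) (by omega) hq, LinearMap.mem_ker]
      exact C.exact_β_δ p (q + 1) q rfl _
  constructor
  · rintro ⟨z, hz⟩
    obtain ⟨z, rfl⟩ := Submodule.mkQ_surjective _ z
    obtain ⟨y, hy⟩ := C.exists_δIter_eq s p q p' q' hp hq z
    rw [C.pageD_mkQ s p q p' q' hp hq z y hy] at hz
    have hxy : C.α p' q' y - x ∈ C.pageBoundaries s p' q' :=
      (Submodule.Quotient.eq ((C.pageBoundaries s p' q').submoduleOf _)).1 hz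
    have := sub_mem (show C.α p' q' y ∈ C.pageBoundaries (s + 1) p' q' from
      ⟨y, (key y).2 ⟨z, hy.symm⟩, rfl⟩) (C.pageBoundaries_le_succ _ _ _ hxy)
    simpa using this
  · rintro ⟨y, hy, hyx⟩
    obtain ⟨z, hz⟩ := (key y).1 hy
    have hz' : z ∈ C.pageCycles s p q := by
      rw [pageCycles, Submodule.mem_comap, hz,
        C.imageFiltration_eq_range s (p' + 1) q' p q hp hq]
      exact ⟨y, rfl⟩
    refine ⟨Submodule.mkQ _ ⟨z, hz'⟩, ?_⟩
    rw [C.pageD_mkQ s p q p' q' hp hq ⟨z, hz'⟩ y hz.symm]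
    exact congrArg (Submodule.mkQ _) (Subtype.ext hyx)

end Differential

end ExactCouple

/-! ### Homology and images as subquotients -/

/-- If `π : Z → S.X₂` is a linear map from a submodule `Z` of a module with image `ker S.g`, and if
the preimage of `range S.f` is `B ∩ Z`, then the homology of `S` is `Z / (B ∩ Z)`. -/
def CategoryTheory.ShortComplex.homologyIsoSubquotient {R : Type u} [Ring R]
    (S : ShortComplex (ModuleCat.{w} R)) {E : Type w} [AddCommGroup E] [Module R E]
    (Z B : Submodule R E) (π : Z →ₗ[R] S.X₂) (hZ : LinearMap.range π = LinearMap.ker S.g.hom)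
    (hB : ∀ x : Z, π x ∈ LinearMap.range S.f.hom ↔ (x : E) ∈ B) :
    S.homology ≅ ModuleCat.of R (Z ⧸ B.submoduleOf Z) :=
  let φ : Z →ₗ[R] LinearMap.ker S.g.hom ⧸ LinearMap.range S.moduleCatToCycles :=
    Submodule.mkQ _ ∘ₗ π.codRestrict _ fun x => hZ ▸ LinearMap.mem_range_self π x
  have hφ : LinearMap.ker φ = B.submoduleOf Z := by
    ext x
    rw [LinearMap.mem_ker, LinearMap.comp_apply, Submodule.mkQ_apply,
      Submodule.Quotient.mk_eq_zero]
    refine Iff.trans ?_ (hB x)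
    exact exists_congr fun y => Subtype.ext_iff
  have hφ' : Function.Surjective φ := by
    refine (Submodule.mkQ_surjective _).comp ?_
    rintro ⟨y, hy⟩
    rw [← hZ] at hy
    obtain ⟨x, rfl⟩ := hy
    exact ⟨x, rfl⟩
  S.moduleCatHomologyIso ≪≫ ((Submodule.quotEquivOfEq _ _ hφ).symm ≪≫ₗ
    φ.quotKerEquivOfSurjective hφ').symm.toModuleIso

/-- The image of a submodule `P` under a linear map `f` is `P / (ker f ∩ P)`. -/
def Submodule.quotientKerSubmoduleOfEquivMap {R M N : Type*} [Ring R] [AddCommGroup M] [Module R M]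
    [AddCommGroup N] [Module R N] (f : M →ₗ[R] N) (P : Submodule R M) :
    (P ⧸ (LinearMap.ker f).submoduleOf P) ≃ₗ[R] P.map f :=
  Submodule.quotEquivOfEq _ _ (LinearMap.ker_domRestrict P f).symm ≪≫ₗ
    (f.domRestrict P).quotKerEquivRange ≪≫ₗ LinearEquiv.ofEq _ _ (LinearMap.range_domRestrict P f)

/-! ### The spectral sequence of an exact couple and its convergence -/

namespace ExactCouple

open RelativeGroupHomology

variable {k : Type} [CommRing k] (C : ExactCouple.{0, w} k)

open scoped Classical in
/-- The page `E^r` of the spectral sequence of an exact couple. -/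
def page (r : ℤ) (hr : 1 ≤ r) :
    HomologicalComplex (ModuleCat.{w} k)
      (ComplexShape.spectralSequenceNat ((-r, r - 1) : ℤ × ℤ)) where
  X pq := ModuleCat.of k (C.pageX (r - 1).toNat pq.1 pq.2)
  d pq pq' :=
    if h : (ComplexShape.spectralSequenceNat ((-r, r - 1) : ℤ × ℤ)).Rel pq pq' then
      ModuleCat.ofHom (C.pageD (r - 1).toNat pq.1 pq.2 pq'.1 pq'.2
        (by have := h.1; dsimp at this; omega) (by have := h.2; dsimp at this; omega))
    else 0
  shape pq pq' h := dif_neg h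
  d_comp_d' pq pq' pq'' h h' := by
    rw [dif_pos h, dif_pos h']
    refine ModuleCat.hom_ext (LinearMap.ext fun x => ?_)
    obtain ⟨x, rfl⟩ := Submodule.mkQ_surjective _ x
    obtain ⟨y, hy⟩ := C.exists_δIter_eq (r - 1).toNat pq.1 pq.2 pq'.1 pq'.2
      (by have := h.1; dsimp at this; omega) (by have := h.2; dsimp at this; omega) x
    refine (congrArg _ (C.pageD_mkQ _ _ _ _ _ _ _ x y hy)).trans ?_
    -- The first differential gives the class of `α y`, and `β (α y) = 0 = δ^s 0`.
    refine (C.pageD_mkQ _ _ _ _ _ _ _ _ 0 ?_).trans (map_zero _)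
    exact (map_zero _).trans (C.β_α _ _ y).symm

lemma page_d {r : ℤ} (hr : 1 ≤ r) {p q p' q' : ℕ} (s : ℕ) (hs : (r - 1).toNat = s)
    (hp : p' + 1 + s = p) (hq : q + s = q') :
    (C.page r hr).d (p, q) (p', q') =
      ModuleCat.ofHom (C.pageD (r - 1).toNat p q p' q' (hs ▸ hp) (hs ▸ hq)) :=
  dif_pos (show (ComplexShape.spectralSequenceNat ((-r, r - 1) : ℤ × ℤ)).Rel (p, q) (p', q') from
    ⟨by dsimp; omega, by dsimp; omega⟩)

/-- The inclusion of cycles induces a map from the cycles of a page to the page before. -/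
def pageCyclesToPage (s p q : ℕ) : C.pageCycles (s + 1) p q →ₗ[k] C.pageX s p q :=
  Submodule.mkQ _ ∘ₗ Submodule.inclusion (C.pageCycles_succ_le s p q)

lemma range_pageCyclesToPage {r : ℤ} (hr : 1 ≤ r) (pq : ℕ × ℕ) :
    LinearMap.range (C.pageCyclesToPage (r - 1).toNat pq.1 pq.2) =
      LinearMap.ker ((C.page r hr).sc pq).g.hom := by
  obtain ⟨p, q⟩ := pq
  ext x
  obtain ⟨x, rfl⟩ := Submodule.mkQ_surjective _ x
  have h₁ : Submodule.mkQ _ x ∈ LinearMap.range (C.pageCyclesToPage (r - 1).toNat p q) ↔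
      (x : C.E p q) ∈ C.pageCycles ((r - 1).toNat + 1) p q := by
    constructor
    · rintro ⟨y, hy⟩
      have hxy := (Submodule.Quotient.eq
        ((C.pageBoundaries (r - 1).toNat p q).submoduleOf _)).1 hy
      have hβ : C.β p q (y - x) = 0 := C.β_eq_zero_of_mem_pageBoundaries hxy
      rw [map_sub, sub_eq_zero] at hβ
      have := y.2
      rwa [mem_pageCycles_iff, hβ] at this
    · exact fun hx => ⟨⟨x, hx⟩, rfl⟩
  refine h₁.trans ?_
  change _ ↔ ((C.page r hr).d (p, q) _).hom _ = 0
  by_cases h : (r - 1).toNat + 1 ≤ p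
  -- The target of the differential lies in the quadrant here. Otherwise the differential is zero,
  -- and the cycles are already stable because `p ≤ s`, where `s = r - 1`.
  · rw [(ComplexShape.spectralSequenceNat _).next_eq'
      (show (ComplexShape.spectralSequenceNat ((-r, r - 1) : ℤ × ℤ)).Rel (p, q)
        (p - ((r - 1).toNat + 1), q + (r - 1).toNat) from ⟨by dsimp; omega, by dsimp; omega⟩),
      C.page_d hr _ rfl (by omega) rfl]
    exact (C.pageD_mkQ_eq_zero_iff _ _ _ _ _ _ _ x).symm
  · rw [(C.page r hr).shape]
    · refine iff_of_true ?_ rfl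
      rw [C.pageCycles_succ_eq _ _ _ (by omega)]
      exact x.2
    · intro h'
      have := h'.1
      dsimp at this
      omega

lemma pageCyclesToPage_mem_range_iff {r : ℤ} (hr : 1 ≤ r) (pq : ℕ × ℕ)
    (x : C.pageCycles ((r - 1).toNat + 1) pq.1 pq.2) :
    C.pageCyclesToPage (r - 1).toNat pq.1 pq.2 x ∈
        LinearMap.range ((C.page r hr).sc pq).f.hom ↔
      (x : C.E pq.1 pq.2) ∈ C.pageBoundaries ((r - 1).toNat + 1) pq.1 pq.2 := by
  obtain ⟨p, q⟩ := pq
  change C.pageCyclesToPage (r - 1).toNat p q x ∈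
    LinearMap.range ((C.page r hr).d _ (p, q)).hom ↔ _
  by_cases h : (r - 1).toNat ≤ q
  -- The source of the differential lies in the quadrant here. Otherwise `q < s` with `s = r - 1`,
  -- and the boundaries are already all of `ker β`.
  · rw [(ComplexShape.spectralSequenceNat _).prev_eq'
      (show (ComplexShape.spectralSequenceNat ((-r, r - 1) : ℤ × ℤ)).Rel
        (p + 1 + (r - 1).toNat, q - (r - 1).toNat) (p, q) from
        ⟨by dsimp; omega, by dsimp; omega⟩), C.page_d hr _ rfl rfl (by omega)]
    exact C.mkQ_mem_range_pageD_iff _ _ _ _ _ _ _ (Submodule.inclusion _ x)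
  · rw [(C.page r hr).shape]
    · have h₀ : C.pageBoundaries ((r - 1).toNat + 1) p q = C.pageBoundaries (r - 1).toNat p q := by
        rw [C.pageBoundaries_eq_ker _ _ _ (by omega), C.pageBoundaries_eq_ker _ _ _ (by omega)]
      have h₁ : C.pageCyclesToPage (r - 1).toNat p q x = 0 ↔
          (x : C.E p q) ∈ C.pageBoundaries (r - 1).toNat p q := Submodule.Quotient.mk_eq_zero _
      refine Iff.trans ?_ (h₁.trans (by rw [h₀]))
      constructor
      · rintro ⟨y, hy⟩
        exact hy.symm
      · exact fun hx => ⟨0, hx.symm⟩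
    · intro h'
      have := h'.2
      dsimp at this
      omega

/-- The spectral sequence of an exact couple. -/
def spectralSequence : FirstQuadrantSpectralSequence.{w} k where
  page r hr := C.page r hr
  iso r r' pq hrr' hr :=
    ((C.page r hr).sc pq).homologyIsoSubquotient _ _ _ (C.range_pageCyclesToPage hr pq)
      (C.pageCyclesToPage_mem_range_iff hr pq) ≪≫ eqToIso (by
        obtain rfl : r' = r + 1 := hrr'.symm
        have : (r + 1 - 1).toNat = (r - 1).toNat + 1 := by omega
        dsimp only [page]
        rw [this])

/-- The identification of `E^1_{p,q}` with the term `E_{p,q}` of an exact couple. -/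
def firstPageXEquiv (p q : ℕ) : C.pageX 0 p q ≃ₗ[k] C.E p q :=
  Submodule.quotEquivOfEqBot _ (by
    rw [pageBoundaries, kernelFiltration, Submodule.map_bot]
    exact Submodule.comap_bot _ |>.trans (Submodule.ker_subtype _)) ≪≫ₗ
  LinearEquiv.ofTop _ (by rw [pageCycles, imageFiltration, Submodule.comap_top])

/-- The first page of the spectral sequence of an exact couple. -/
def firstPageXIso (p q : ℕ) : C.spectralSequence.firstPage.X (p, q) ≅ C.E p q :=
  (C.firstPageXEquiv p q).toModuleIso

lemma firstPage_d_comp_firstPageXIso_hom (p q : ℕ) :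
    C.spectralSequence.firstPage.d (p + 1, q) (p, q) ≫ (C.firstPageXIso p q).hom =
      (C.firstPageXIso (p + 1) q).hom ≫
        ModuleCat.ofHom (C.α p q ∘ₗ C.β (p + 1) q) := by
  refine ModuleCat.hom_ext (LinearMap.ext fun x => ?_)
  change C.pageX 0 (p + 1) q at x
  obtain ⟨x, rfl⟩ := Submodule.mkQ_surjective _ x
  have h := C.page_d le_rfl (p := p + 1) (q := q) (p' := p) (q' := q) 0 rfl rfl rfl
  refine (congrArg (C.firstPageXEquiv p q) (congr($(h).hom (Submodule.mkQ _ x)))).trans ?_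
  exact congrArg (C.firstPageXEquiv p q)
    (C.pageD_mkQ 0 (p + 1) q p q rfl rfl x (C.β (p + 1) q x) rfl)

/-- The limit term of the spectral sequence of an exact couple. -/
def infinityEquiv (p q : ℕ) : C.spectralSequence.infinity p q ≃ₗ[k] C.pageX (p + q + 1) p q :=
  (eqToIso (show C.spectralSequence.infinity p q = ModuleCat.of k (C.pageX (p + q + 1) p q) by
    have : ((p : ℤ) + q + 2 - 1).toNat = p + q + 1 := by omega
    change ModuleCat.of k (C.pageX ((p : ℤ) + q + 2 - 1).toNat p q) = _
    rw [this])).toLinearEquiv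

/-- Both sides equal `im δ^p ∩ im β`: the image filtration is constant from `s = p` on, and `δ^p y ∈
im β = ker δ` means `y ∈ ker δ^{p+1}`. -/
lemma map_β_pageCycles (p q s : ℕ) (hs : p ≤ s) :
    (C.pageCycles s p q).map (C.β p q) =
      (C.kernelFiltration (p + 1) 0 (p + q)).map
        (C.δIter p 0 (p + q) p q (by omega) (by omega)) := by
  have hI : C.imageFiltration s p q =
      LinearMap.range (C.δIter p 0 (p + q) p q (by omega) (by omega)) := by
    induction s, hs using Nat.le_induction with
    | base => exact C.imageFiltration_eq_range _ _ _ _ _ _ _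
    | succ s hs ih => rw [C.imageFiltration_succ_eq _ _ _ hs, ih]
  have hK (y : C.A 0 (p + q)) : y ∈ C.kernelFiltration (p + 1) 0 (p + q) ↔
      C.δIter p 0 (p + q) p q (by omega) (by omega) y ∈ LinearMap.range (C.β p q) := by
    cases q with
    | zero =>
      rw [C.kernelFiltration_eq_top _ _ _ (by omega),
        LinearMap.range_eq_top.2 (C.surjective_β p)]
      simp
    | succ q =>
      rw [C.kernelFiltration_eq_ker (p + 1) 0 (p + (q + 1)) (p + 1) q (by omega) (by omega),
        C.δIter_succ_left p 0 (p + (q + 1)) p q (by omega) (by omega) (by omega) (by omega)]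
      exact C.exact_β_δ p (q + 1) q rfl _
  ext z
  constructor
  · rintro ⟨x, hx, rfl⟩
    rw [SetLike.mem_coe, mem_pageCycles_iff, hI] at hx
    obtain ⟨y, hy⟩ := hx
    exact ⟨y, (hK y).2 ⟨x, hy.symm⟩, hy⟩
  · rintro ⟨y, hy, rfl⟩
    obtain ⟨x, hx⟩ := (hK y).1 hy
    refine ⟨x, ?_, hx⟩
    rw [SetLike.mem_coe, mem_pageCycles_iff, hI, hx]
    exact ⟨y, rfl⟩

/-- The spectral sequence of a first-quadrant exact couple converges to the terms `A_{0,n}`, with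
the filtration by the kernels of the iterated connecting maps. -/
theorem spectralSequence_convergesTo : C.spectralSequence.ConvergesTo (fun n => C.A 0 n) := by
  intro n
  -- The shift by one makes `F_{-1}` the kernel of `δ^0 = id`; `F_n` is everything because `δ^{n+1}`
  -- leaves the quadrant.
  refine ⟨fun z => C.kernelFiltration (z + 1).toNat 0 n, ?_, rfl, ?_, ?_⟩
  · exact (monotone_nat_of_le_succ fun s => C.kernelFiltration_le_succ s 0 n).comp
      fun a b hab => Int.toNat_le_toNat (by omega)
  · exact C.kernelFiltration_eq_top _ _ _ (by omega)
  · rintro p q rfl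
    have key : ∀ F₁ F₂ : Submodule k (C.A 0 (p + q)), F₁ = C.kernelFiltration (p + 1) 0 (p + q) →
        F₂ = LinearMap.ker (C.δIter p 0 (p + q) p q (by omega) (by omega)) →
        Nonempty ((F₁ ⧸ F₂.submoduleOf F₁) ≃ₗ[k] C.spectralSequence.infinity p q) := by
      rintro _ _ rfl rfl
      -- Both quotients are images: of `F_p` under `δ^p` and of the limit cycles under `β`.
      refine ⟨Submodule.quotientKerSubmoduleOfEquivMap _ _ ≪≫ₗ
        LinearEquiv.ofEq _ _ (C.map_β_pageCycles p q (p + q + 1) (by omega)).symm ≪≫ₗ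
        (Submodule.quotientKerSubmoduleOfEquivMap _ _).symm ≪≫ₗ
        Submodule.quotEquivOfEq _ _ ?_ ≪≫ₗ (C.infinityEquiv p q).symm⟩
      rw [C.pageBoundaries_eq_ker _ _ _ (by omega)]
    refine key _ _ ?_ ?_
    · dsimp only
      rw [show ((p : ℤ) + 1).toNat = p + 1 by omega]
    · dsimp only
      rw [show ((p : ℤ) - 1 + 1).toNat = p by omega]
      exact C.kernelFiltration_eq_ker p 0 (p + q) p q (by omega) (by omega)

end ExactCouple

/-! ### The spectral sequence of a resolution of a complex -/

namespace CategoryTheory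

open Limits

/-- A left resolution `⋯ → P_1 → P_0 → Q → 0` of an object of an abelian category. -/
structure LeftResolutionData {𝒞 : Type u} [Category.{v} 𝒞] [Abelian 𝒞] (Q : 𝒞) where
  /-- The terms of the resolution. -/
  P : ℕ → 𝒞
  /-- The differentials of the resolution. -/
  d (p : ℕ) : P (p + 1) ⟶ P p
  /-- The augmentation. -/
  ε : P 0 ⟶ Q
  d_d (p : ℕ) : d (p + 1) ≫ d p = 0
  d_ε : d 0 ≫ ε = 0
  exact_succ (p : ℕ) : (ShortComplex.mk _ _ (d_d p)).Exact
  exact_zero : (ShortComplex.mk _ _ d_ε).Exact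
  epi_ε : Epi ε

namespace LeftResolutionData

variable {𝒞 : Type u} [Category.{v} 𝒞] [Abelian 𝒞] {Q : 𝒞} (L : LeftResolutionData Q)

/-- The syzygies `Z_0 = Q`, `Z_1 = ker ε` and `Z_{p+2} = ker (P_{p+1} → P_p)`. -/
def syzygy : ℕ → 𝒞
  | 0 => Q
  | 1 => kernel L.ε
  | p + 2 => kernel (L.d p)

/-- The inclusion `Z_{p+1} → P_p`. -/
def syzygyι : ∀ p, L.syzygy (p + 1) ⟶ L.P p
  | 0 => kernel.ι L.ε
  | p + 1 => kernel.ι (L.d p)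

/-- The projection `P_p → Z_p`. -/
def toSyzygy : ∀ p, L.P p ⟶ L.syzygy p
  | 0 => L.ε
  | 1 => kernel.lift _ _ L.d_ε
  | p + 2 => kernel.lift _ _ (L.d_d p)

@[simp]
lemma toSyzygy_syzygyι (p : ℕ) : L.toSyzygy (p + 1) ≫ L.syzygyι p = L.d p := by
  cases p <;> exact kernel.lift_ι _ _ _

instance (p : ℕ) : Mono (L.syzygyι p) := by
  cases p <;> exact inferInstanceAs (Mono (kernel.ι _))

instance (p : ℕ) : Epi (L.toSyzygy p) := by
  match p with
  | 0 => exact L.epi_ε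
  | 1 => exact L.exact_zero.epi_kernelLift
  | p + 2 => exact (L.exact_succ p).epi_kernelLift

lemma syzygyι_toSyzygy (p : ℕ) : L.syzygyι p ≫ L.toSyzygy p = 0 := by
  cases p with
  | zero => exact kernel.condition _
  | succ p =>
    rw [← cancel_mono (L.syzygyι p), Category.assoc, toSyzygy_syzygyι, zero_comp]
    exact kernel.condition _

/-- The short exact sequence `0 → Z_{p+1} → P_p → Z_p → 0`. -/
abbrev syzygySequence (p : ℕ) : ShortComplex 𝒞 :=
  ShortComplex.mk _ _ (L.syzygyι_toSyzygy p)

lemma syzygySequence_shortExact (p : ℕ) : (L.syzygySequence p).ShortExact where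
  exact := by
    refine ShortComplex.exact_of_f_is_kernel _ ?_
    cases p with
    | zero => exact kernelIsKernel L.ε
    | succ p =>
      exact isKernelOfComp (L.syzygyι p) (L.d p) (kernelIsKernel (L.d p)) _
        (L.toSyzygy_syzygyι p)

end LeftResolutionData

end CategoryTheory

/-- The exact couple of a left resolution of a complex of modules, consisting of the long exact
homology sequences of the short exact sequences of syzygies. -/
def CategoryTheory.LeftResolutionData.exactCouple {k : Type u} [CommRing k]
    {Q : ChainComplex (ModuleCat.{w} k) ℕ} (L : LeftResolutionData Q) : ExactCouple.{u, w} k where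
  A p q := (L.syzygy p).homology q
  E p q := (L.P p).homology q
  α p q := (HomologicalComplex.homologyMap (L.syzygyι p) q).hom
  β p q := (HomologicalComplex.homologyMap (L.toSyzygy p) q).hom
  δ p q q' h := ((L.syzygySequence_shortExact p).δ q q' h).hom
  exact_α_β p q := (ShortComplex.ShortExact.moduleCat_exact_iff_function_exact _).1
    ((L.syzygySequence_shortExact p).homology_exact₂ q)
  exact_β_δ p q q' h := (ShortComplex.ShortExact.moduleCat_exact_iff_function_exact _).1
    ((L.syzygySequence_shortExact p).homology_exact₃ q q' h)
  exact_δ_α p q q' h := (ShortComplex.ShortExact.moduleCat_exact_iff_function_exact _).1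
    ((L.syzygySequence_shortExact p).homology_exact₁ q q' h)
  surjective_β p := by
    -- Nothing leaves degree `0`, so homology there preserves epimorphisms.
    have := HomologicalComplex.epi_homologyMap_of_epi_of_not_rel (L.toSyzygy p) 0 (by simp)
    exact (ModuleCat.epi_iff_surjective _).1 this

/-- A left resolution `⋯ → P_1 → P_0 → Q → 0` of a complex of modules gives rise to a spectral
sequence `H_q(P_p) ⇒ H_{p+q}(Q)`. -/
theorem CategoryTheory.LeftResolutionData.exists_spectralSequence {k : Type} [CommRing k]
    {Q : ChainComplex (ModuleCat.{w} k) ℕ} (L : LeftResolutionData Q) :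
    ∃ (E : RelativeGroupHomology.FirstQuadrantSpectralSequence.{w} k)
      (e : ∀ p q : ℕ, E.firstPage.X (p, q) ≅ (L.P p).homology q),
      (∀ p q : ℕ, E.firstPage.d (p + 1, q) (p, q) ≫ (e p q).hom =
        (e (p + 1) q).hom ≫ HomologicalComplex.homologyMap (L.d p) q) ∧
      E.ConvergesTo (fun n => Q.homology n) := by
  refine ⟨L.exactCouple.spectralSequence, L.exactCouple.firstPageXIso, fun p q => ?_,
    L.exactCouple.spectralSequence_convergesTo⟩
  refine (L.exactCouple.firstPage_d_comp_firstPageXIso_hom p q).trans ?_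
  rw [← L.toSyzygy_syzygyι, HomologicalComplex.homologyMap_comp]
  rfl

/-! ### Exactness of the relative chain complexes -/

lemma Finsupp.mapRange_linearMap_exact {R ι M N P : Type*} [Ring R] [AddCommGroup M] [Module R M]
    [AddCommGroup N] [Module R N] [AddCommGroup P] [Module R P] {f : M →ₗ[R] N} {g : N →ₗ[R] P}
    (h : Function.Exact f g) :
    Function.Exact (Finsupp.mapRange.linearMap (α := ι) f)
      (Finsupp.mapRange.linearMap (α := ι) g) := by
  classical
  intro x
  constructor
  · intro hx
    -- A set-theoretic section of `f` over `ker g`; forcing `s 0 = 0` keeps supports finite.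
    let s : N → M := fun y => if hy : y ≠ 0 ∧ g y = 0 then ((h y).1 hy.2).choose else 0
    have hs (y : N) (hy : g y = 0) : f (s y) = y := by
      by_cases hy₀ : y = 0
      · simp [s, hy₀]
      · simp only [s, dif_pos (And.intro hy₀ hy)]
        exact ((h y).1 hy).choose_spec
    refine ⟨x.mapRange s (by simp [s]), Finsupp.ext fun i => ?_⟩
    simpa using hs (x i) (by simpa using DFunLike.congr_fun hx i)
  · rintro ⟨y, rfl⟩
    ext i
    simp [h.apply_apply_eq_zero]

namespace RelativeGroupHomology

variable {k : Type} [CommRing k]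

/-! ### Chains as direct sums of copies of the coefficients -/

section

variable {G : Type u} [Group G] (M : Rep.{v} k G) (n : ℕ)

/-- The map `k[G^{n+1}] ⊗_G M → ⨁_{G^n} M` sending `(g_0, …, g_n) ⊗ m` to `g_0⁻¹ m` in the summand
of `(g_0⁻¹ g_1, …, g_0⁻¹ g_n)`. -/
def coinvariantsToFinsupp :
    ((Representation.ofMulAction k G (Fin (n + 1) → G)).tprod M.ρ).Coinvariants →ₗ[k]
      ((Fin n → G) →₀ M.V) :=
  Representation.Coinvariants.lift _
    (TensorProduct.lift (Finsupp.lsum k (fun x : Fin (n + 1) → G =>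
      LinearMap.toSpanSingleton k (M.V →ₗ[k] ((Fin n → G) →₀ M.V))
        (Finsupp.lsingle (fun i => (x 0)⁻¹ * x i.succ) ∘ₗ M.ρ (x 0)⁻¹)) ∘ₗ
      (MonoidAlgebra.coeffLinearEquiv k).toLinearMap))
    (fun g => by
      ext x m : 4
      simp [mul_assoc])

lemma coinvariantsToFinsupp_mk (x : Fin (n + 1) → G) (r : k) (m : M.V) :
    coinvariantsToFinsupp M n
      (Representation.Coinvariants.mk _ (MonoidAlgebra.single x r ⊗ₜ[k] m)) =
      Finsupp.single (fun i => (x 0)⁻¹ * x i.succ) (r • M.ρ (x 0)⁻¹ m) := by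
  simp [coinvariantsToFinsupp]

/-- The map `⨁_{G^n} M → k[G^{n+1}] ⊗_G M` sending `m` in the summand of `(g_1, …, g_n)` to
`(1, g_1, …, g_n) ⊗ m`. -/
def finsuppToCoinvariants :
    ((Fin n → G) →₀ M.V) →ₗ[k]
      ((Representation.ofMulAction k G (Fin (n + 1) → G)).tprod M.ρ).Coinvariants :=
  Finsupp.lsum k fun y => Representation.Coinvariants.mk _ ∘ₗ
    TensorProduct.mk k _ _ (MonoidAlgebra.single (Fin.cons 1 y : Fin (n + 1) → G) (1 : k))

lemma finsuppToCoinvariants_single (y : Fin n → G) (m : M.V) :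
    finsuppToCoinvariants M n (Finsupp.single y m) = Representation.Coinvariants.mk _
      (MonoidAlgebra.single (Fin.cons 1 y : Fin (n + 1) → G) (1 : k) ⊗ₜ[k] m) := by
  simp [finsuppToCoinvariants]

/-- `k[G^{n+1}] ⊗_G M` is the direct sum of copies of `M` indexed by `G^n`. -/
def coinvariantsEquivFinsupp :
    ((Representation.ofMulAction k G (Fin (n + 1) → G)).tprod M.ρ).Coinvariants ≃ₗ[k]
      ((Fin n → G) →₀ M.V) :=
  LinearEquiv.ofLinearMap (coinvariantsToFinsupp M n) (finsuppToCoinvariants M n)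
    (by
      ext y m : 2
      simp [finsuppToCoinvariants_single, coinvariantsToFinsupp_mk])
    (by
      refine Representation.Coinvariants.hom_ext (TensorProduct.ext ?_)
      refine MonoidAlgebra.lhom_ext' fun x => LinearMap.ext_ring (LinearMap.ext fun m => ?_)
      change finsuppToCoinvariants M n (coinvariantsToFinsupp M n (Representation.Coinvariants.mk _
        (MonoidAlgebra.single x (1 : k) ⊗ₜ[k] m))) = Representation.Coinvariants.mk _
        (MonoidAlgebra.single x (1 : k) ⊗ₜ[k] m)
      -- Acting by `(x 0)⁻¹` does not change the class and makes the first entry of the tuple `1`.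
      rw [coinvariantsToFinsupp_mk, one_smul, finsuppToCoinvariants_single,
        ← Representation.Coinvariants.mk_self_apply _ (x 0)⁻¹
          (MonoidAlgebra.single x (1 : k) ⊗ₜ[k] m)]
      have h : (x 0)⁻¹ • x = Fin.cons 1 fun i => (x 0)⁻¹ * x i.succ := by
        ext i
        cases i using Fin.cases <;> simp
      simp [h])

end

/-! ### Injectivity and exactness of the induced maps -/

section

variable {G' G : Type u} [Group G'] [Group G]

/-- Normalising the first entry commutes with the homomorphism `f`. In the direct sum model the
induced map thus acts separately on coefficients and on indices. -/
lemma coinvariantsToFinsupp_chainsMapAux {M' : Rep.{v} k G'} {M : Rep.{v} k G} (f : G' →* G)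
    (σ : M' ⟶ Rep.res f M) (n : ℕ)
    (z : ((Representation.ofMulAction k G' (Fin (n + 1) → G')).tprod M'.ρ).Coinvariants) :
    coinvariantsToFinsupp M n (chainsMapAux f σ n z) =
      Finsupp.lmapDomain _ k (fun y => f ∘ y) (Finsupp.mapRange.linearMap σ.hom.toLinearMap
        (coinvariantsToFinsupp M' n z)) := by
  have h : coinvariantsToFinsupp M n ∘ₗ chainsMapAux f σ n =
      Finsupp.lmapDomain _ k (fun y => f ∘ y) ∘ₗ
        Finsupp.mapRange.linearMap σ.hom.toLinearMap ∘ₗ coinvariantsToFinsupp M' n := by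
    refine Representation.Coinvariants.hom_ext (TensorProduct.ext ?_)
    refine MonoidAlgebra.lhom_ext' fun x => LinearMap.ext_ring (LinearMap.ext fun m => ?_)
    change coinvariantsToFinsupp M n (Representation.Coinvariants.mk _
        (MonoidAlgebra.mapDomain (fun x => f ∘ x) (MonoidAlgebra.single x (1 : k)) ⊗ₜ[k]
          σ.hom m)) = Finsupp.lmapDomain _ k (fun y => f ∘ y)
        (Finsupp.mapRange.linearMap σ.hom.toLinearMap (coinvariantsToFinsupp M' n
          (Representation.Coinvariants.mk _ (MonoidAlgebra.single x (1 : k) ⊗ₜ[k] m))))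
    have hσ : σ.hom (M'.ρ (x 0)⁻¹ m) = M.ρ (f (x 0))⁻¹ (σ.hom m) := by
      rw [← map_inv]
      exact Rep.hom_comm_apply σ _ m
    rw [MonoidAlgebra.mapDomain_single, coinvariantsToFinsupp_mk, coinvariantsToFinsupp_mk]
    have hf : (fun i : Fin n => (f (x 0))⁻¹ * f (x i.succ)) =
        f ∘ fun i => (x 0)⁻¹ * x i.succ := by
      ext i
      simp
    simp [hσ, hf]
  exact LinearMap.congr_fun h z

lemma chainsMapAux_injective {M' : Rep.{v} k G'} {M : Rep.{v} k G} (f : G' →* G)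
    (hf : Function.Injective f) (σ : M' ⟶ Rep.res f M) (hσ : Function.Injective σ.hom) (n : ℕ) :
    Function.Injective (chainsMapAux f σ n) := by
  refine Function.Injective.of_comp (f := coinvariantsToFinsupp M n) ?_
  have : coinvariantsToFinsupp M n ∘ chainsMapAux f σ n =
      Finsupp.mapDomain (fun y => f ∘ y) ∘ Finsupp.mapRange σ.hom (map_zero _) ∘
        coinvariantsEquivFinsupp M' n :=
    funext (coinvariantsToFinsupp_chainsMapAux f σ n)
  rw [this]
  exact (Finsupp.mapDomain_injective hf.comp_left).comp
    ((Finsupp.mapRange_injective _ _ hσ).comp (coinvariantsEquivFinsupp M' n).injective)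

lemma coinvariantsEquivFinsupp_chainsMapAux_id {M₁ M₂ : Rep.{v} k G} (a : M₁ ⟶ M₂) (n : ℕ)
    (z : ((Representation.ofMulAction k G (Fin (n + 1) → G)).tprod M₁.ρ).Coinvariants) :
    coinvariantsEquivFinsupp M₂ n (chainsMapAux (MonoidHom.id G) a n z) =
      Finsupp.mapRange.linearMap a.hom.toLinearMap (coinvariantsEquivFinsupp M₁ n z) :=
  (coinvariantsToFinsupp_chainsMapAux (MonoidHom.id G) a n z).trans (Finsupp.mapDomain_id)

lemma chainsMapAux_id_exact {M₁ M₂ M₃ : Rep.{v} k G} (a : M₁ ⟶ M₂) (b : M₂ ⟶ M₃)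
    (h : Function.Exact a.hom b.hom) (n : ℕ) :
    Function.Exact (chainsMapAux (MonoidHom.id G) a n) (chainsMapAux (MonoidHom.id G) b n) :=
  (Function.Exact.iff_of_ladder_linearEquiv (e₁ := coinvariantsEquivFinsupp M₁ n)
    (e₂ := coinvariantsEquivFinsupp M₂ n) (e₃ := coinvariantsEquivFinsupp M₃ n)
    (LinearMap.ext fun z => (coinvariantsEquivFinsupp_chainsMapAux_id a n z).symm)
    (LinearMap.ext fun z => (coinvariantsEquivFinsupp_chainsMapAux_id b n z).symm)).1
    (Finsupp.mapRange_linearMap_exact h)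

lemma chainsMapAux_id_surjective {M₁ M₂ : Rep.{v} k G} (a : M₁ ⟶ M₂)
    (h : Function.Surjective a.hom) (n : ℕ) :
    Function.Surjective (chainsMapAux (MonoidHom.id G) a n) := by
  intro y
  obtain ⟨z, hz⟩ := Finsupp.mapRange_surjective (α := Fin n → G) _ (map_zero a.hom) h
    (coinvariantsEquivFinsupp M₂ n y)
  refine ⟨(coinvariantsEquivFinsupp M₁ n).symm z, (coinvariantsEquivFinsupp M₂ n).injective ?_⟩
  rw [coinvariantsEquivFinsupp_chainsMapAux_id, LinearEquiv.apply_symm_apply]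
  exact hz

end

end RelativeGroupHomology

/-! ### The resolution of the relative chain complex -/

/-- Exactness of a sequence `Q₁ → Q₂ → Q₃` of quotients `Qᵢ` of modules `Xᵢ` by submodules `Xᵢ'`,
if `X₁ → X₂ → X₃` is exact and if an element of `X₂` that maps to `X₃'` can be corrected by an
element of `X₂'`. -/
lemma Function.Exact.of_quotients {R X₁ X₂ X₃ Y₂ Y₃ Q₁ Q₂ Q₃ : Type*} [Ring R]
    [AddCommGroup X₁] [Module R X₁] [AddCommGroup X₂] [Module R X₂] [AddCommGroup X₃] [Module R X₃]
    [AddCommGroup Y₂] [Module R Y₂] [AddCommGroup Y₃] [Module R Y₃]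
    [AddCommGroup Q₁] [Module R Q₁] [AddCommGroup Q₂] [Module R Q₂] [AddCommGroup Q₃] [Module R Q₃]
    {f : X₁ →ₗ[R] X₂} {g : X₂ →ₗ[R] X₃} {g' : Y₂ →ₗ[R] Y₃} {j₂ : Y₂ →ₗ[R] X₂} {j₃ : Y₃ →ₗ[R] X₃}
    {π₁ : X₁ →ₗ[R] Q₁} {π₂ : X₂ →ₗ[R] Q₂} {π₃ : X₃ →ₗ[R] Q₃} {fQ : Q₁ →ₗ[R] Q₂} {gQ : Q₂ →ₗ[R] Q₃}
    (hfg : Function.Exact f g) (hj₂ : ∀ y, π₂ (j₂ y) = 0) (hj₃ : Function.Exact j₃ π₃)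
    (hπ₁ : Function.Surjective π₁) (hπ₂ : Function.Surjective π₂)
    (hf : ∀ x, fQ (π₁ x) = π₂ (f x)) (hg : ∀ x, gQ (π₂ x) = π₃ (g x))
    (hg' : ∀ y, g (j₂ y) = j₃ (g' y)) (h : ∀ x y, g x = j₃ y → ∃ y', g' y' = y) :
    Function.Exact fQ gQ := by
  intro q
  constructor
  · intro hq
    obtain ⟨x, rfl⟩ := hπ₂ q
    rw [hg] at hq
    obtain ⟨y, hy⟩ := (hj₃ _).1 hq
    obtain ⟨y', rfl⟩ := h x y hy.symm
    obtain ⟨z, hz⟩ := (hfg (x - j₂ y')).1 (by rw [map_sub, hg', hy, sub_self])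
    exact ⟨π₁ z, by rw [hf, hz, map_sub, hj₂, sub_zero]⟩
  · rintro ⟨p, rfl⟩
    obtain ⟨z, rfl⟩ := hπ₁ p
    rw [hf, hg, hfg.apply_apply_eq_zero, map_zero]

namespace RelativeGroupHomology

open Limits

variable {k : Type} [CommRing k] {G' G : Type u} [Group G'] [Group G] {f : G' →* G}

/-- The projection `C_•(G) ⊗_G M → (C_•(G) ⊗_G M) / (C_•(G') ⊗_{G'} M')`. -/
def relChainsπ {M' : Rep.{v} k G'} {M : Rep.{v} k G} (σ : M' ⟶ Rep.res f M) :
    chains M ⟶ relChains f σ :=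
  cokernel.π (chainsMap f σ)

instance {M' : Rep.{v} k G'} {M : Rep.{v} k G} (σ : M' ⟶ Rep.res f M) : Epi (relChainsπ σ) :=
  inferInstanceAs (Epi (cokernel.π _))

lemma chainsMap_relChainsπ {M' : Rep.{v} k G'} {M : Rep.{v} k G} (σ : M' ⟶ Rep.res f M) :
    chainsMap f σ ≫ relChainsπ σ = 0 :=
  cokernel.condition _

lemma relChainsπ_f_surjective {M' : Rep.{v} k G'} {M : Rep.{v} k G} (σ : M' ⟶ Rep.res f M)
    (n : ℕ) : Function.Surjective ((relChainsπ σ).f n).hom :=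
  (ModuleCat.epi_iff_surjective _).1 inferInstance

/-- Evaluation in a degree preserves exactness, so the cokernel of complexes is the degreewise
quotient. -/
lemma chainsMapAux_relChainsπ_f_exact {M' : Rep.{v} k G'} {M : Rep.{v} k G}
    (σ : M' ⟶ Rep.res f M) (n : ℕ) :
    Function.Exact (chainsMapAux f σ n) ((relChainsπ σ).f n).hom :=
  (ShortComplex.ShortExact.moduleCat_exact_iff_function_exact _).1
    ((ShortComplex.exact_cokernel (chainsMap f σ)).map (HomologicalComplex.eval _ _ n))

section

variable {M₁' M₂' M₃' : Rep.{v} k G'} {M₁ M₂ M₃ : Rep.{v} k G} {σ₁ : M₁' ⟶ Rep.res f M₁}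
  {σ₂ : M₂' ⟶ Rep.res f M₂} {σ₃ : M₃' ⟶ Rep.res f M₃}

/-- The map of relative chain complexes induced by a morphism of pairs of coefficients. -/
abbrev relChainsMap (a' : M₁' ⟶ M₂') (a : M₁ ⟶ M₂)
    (h : σ₁ ≫ (Rep.resFunctor f).map a = a' ≫ σ₂) : relChains f σ₁ ⟶ relChains f σ₂ :=
  cokernel.map (chainsMap f σ₁) (chainsMap f σ₂) (chainsCoeffMap a') (chainsCoeffMap a)
    (chainsMap_comm a' a h)

lemma relChainsMap_f_relChainsπ_f (a' : M₁' ⟶ M₂') (a : M₁ ⟶ M₂)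
    (h : σ₁ ≫ (Rep.resFunctor f).map a = a' ≫ σ₂) (n : ℕ) (x : (chains M₁).X n) :
    ((relChainsMap a' a h).f n).hom (((relChainsπ σ₁).f n).hom x) =
      ((relChainsπ σ₂).f n).hom (chainsMapAux (MonoidHom.id G) a n x) := by
  have := congr((($(cokernel.π_desc (chainsMap f σ₁) (chainsCoeffMap a ≫ relChainsπ σ₂)
    (by rw [← Category.assoc, chainsMap_comm a' a h, Category.assoc, chainsMap_relChainsπ,
      comp_zero]))).f n).hom x)
  exact this

lemma relChainsMap_f_surjective (a' : M₁' ⟶ M₂') (a : M₁ ⟶ M₂)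
    (h : σ₁ ≫ (Rep.resFunctor f).map a = a' ≫ σ₂) (ha : Function.Surjective a.hom) (n : ℕ) :
    Function.Surjective ((relChainsMap a' a h).f n).hom := by
  intro q
  obtain ⟨x, rfl⟩ := relChainsπ_f_surjective σ₂ n q
  obtain ⟨y, rfl⟩ := chainsMapAux_id_surjective a ha n x
  exact ⟨_, relChainsMap_f_relChainsπ_f a' a h n y⟩

/-- The hypothesis `h` is what exactness of the primed row at `M₃'` must supply: a chain over `M₃'`
that is a boundary value from `M₂` already comes from `M₂'`. -/
lemma relChainsMap_f_exact (a' : M₁' ⟶ M₂') (a : M₁ ⟶ M₂)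
    (ha : σ₁ ≫ (Rep.resFunctor f).map a = a' ≫ σ₂) (b' : M₂' ⟶ M₃') (b : M₂ ⟶ M₃)
    (hb : σ₂ ≫ (Rep.resFunctor f).map b = b' ≫ σ₃) (hab : Function.Exact a.hom b.hom) (n : ℕ)
    (h : ∀ x y, chainsMapAux (MonoidHom.id G) b n x = chainsMapAux f σ₃ n y →
      ∃ y', chainsMapAux (MonoidHom.id G') b' n y' = y) :
    Function.Exact ((relChainsMap a' a ha).f n).hom ((relChainsMap b' b hb).f n).hom :=
  Function.Exact.of_quotients (chainsMapAux_id_exact a b hab n)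
    (fun y => (chainsMapAux_relChainsπ_f_exact σ₂ n).apply_apply_eq_zero y)
    (chainsMapAux_relChainsπ_f_exact σ₃ n)
    (relChainsπ_f_surjective σ₁ n) (relChainsπ_f_surjective σ₂ n)
    (relChainsMap_f_relChainsπ_f a' a ha n) (relChainsMap_f_relChainsπ_f b' b hb n)
    (fun y => congr((($(chainsMap_comm b' b hb)).f n).hom y)) h

lemma relChainsMap_exact (a' : M₁' ⟶ M₂') (a : M₁ ⟶ M₂)
    (ha : σ₁ ≫ (Rep.resFunctor f).map a = a' ≫ σ₂) (b' : M₂' ⟶ M₃') (b : M₂ ⟶ M₃)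
    (hb : σ₂ ≫ (Rep.resFunctor f).map b = b' ≫ σ₃) (hab : Function.Exact a.hom b.hom)
    (h : ∀ n x y, chainsMapAux (MonoidHom.id G) b n x = chainsMapAux f σ₃ n y →
      ∃ y', chainsMapAux (MonoidHom.id G') b' n y' = y) :
    ∃ w : relChainsMap a' a ha ≫ relChainsMap b' b hb = 0, (ShortComplex.mk _ _ w).Exact := by
  have H (n : ℕ) := relChainsMap_f_exact a' a ha b' b hb hab n (h n)
  refine ⟨HomologicalComplex.hom_ext _ _ fun n => ModuleCat.hom_ext (LinearMap.ext
    (H n).apply_apply_eq_zero), HomologicalComplex.exact_of_degreewise_exact _ fun n => ?_⟩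
  exact (ShortComplex.ShortExact.moduleCat_exact_iff_function_exact _).2 (H n)

end

/-- The resolution of a relative chain complex given by a pair of resolutions of the
coefficients. -/
def relChainsResolution (hf : Function.Injective f) {L : ChainComplex (Rep.{v} k G) ℕ}
    {M : Rep.{v} k G} {ε : L.X 0 ⟶ M} (hL : IsExactOver L ε) {L' : ChainComplex (Rep.{v} k G') ℕ}
    {M' : Rep.{v} k G'} {ε' : L'.X 0 ⟶ M'} (hL' : IsExactOver L' ε')
    (ι : L' ⟶ ((Rep.resFunctor f).mapHomologicalComplex _).obj L)
    (hι : ∀ p, Function.Injective (ι.f p).hom)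
    (σ : M' ⟶ Rep.res f M) (hσ : Function.Injective σ.hom)
    (hισ : ι.f 0 ≫ (Rep.resFunctor f).map ε = ε' ≫ σ) :
    LeftResolutionData (relChains f σ) :=
  have lift {M₁' M₂' M₃' : Rep.{v} k G'} {M₁ M₂ M₃ : Rep.{v} k G} {σ₁ : M₁' ⟶ Rep.res f M₁}
      {σ₂ : M₂' ⟶ Rep.res f M₂} {σ₃ : M₃' ⟶ Rep.res f M₃} {a' : M₁' ⟶ M₂'} {a : M₁ ⟶ M₂}
      (ha : σ₁ ≫ (Rep.resFunctor f).map a = a' ≫ σ₂) {b' : M₂' ⟶ M₃'} {b : M₂ ⟶ M₃}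
      (hb : σ₂ ≫ (Rep.resFunctor f).map b = b' ≫ σ₃) (h : Function.Exact a.hom b.hom)
      (h' : Function.Exact a'.hom b'.hom) (hσ₃ : Function.Injective σ₃.hom) (n : ℕ) (x y)
      (hxy : chainsMapAux (MonoidHom.id G) a n x = chainsMapAux f σ₂ n y) :
      ∃ y', chainsMapAux (MonoidHom.id G') a' n y' = y := by
    -- By exactness it suffices that `b'` kills `y`. This is tested after the injection `σ₃`, where
    -- the image of `y` becomes `b (a x) = 0`.
    refine (chainsMapAux_id_exact a' b' h' n y).1 (chainsMapAux_injective f hf σ₃ hσ₃ n ?_)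
    have := congr((($(chainsMap_comm b' b hb)).f n).hom y)
    refine Eq.trans this.symm ?_
    refine (congrArg (chainsMapAux (MonoidHom.id G) b n) hxy.symm).trans ?_
    exact ((chainsMapAux_id_exact a b h n).apply_apply_eq_zero x).trans (map_zero _).symm
  have succ (p : ℕ) := relChainsMap_exact (L'.d (p + 2) (p + 1)) (L.d (p + 2) (p + 1))
    (ι.comm (p + 2) (p + 1)) (L'.d (p + 1) p) (L.d (p + 1) p) (ι.comm (p + 1) p)
    -- Exactness at `P_{p+1}` needs exactness of the primed complex one place further right, at
    -- `L'_p`; for `p = 0` the next map is the augmentation.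
    (hL.exact_succ p) <| by
      cases p with
      | zero => exact lift (ι.comm 1 0) hισ hL.exact_zero hL'.exact_zero hσ
      | succ p =>
        exact lift (ι.comm (p + 2) (p + 1)) (ι.comm (p + 1) p) (hL.exact_succ p)
          (hL'.exact_succ p) (hι p)
  -- At the end no chase is needed: every chain over `M'` lifts because `ε'` is surjective.
  have zero := relChainsMap_exact (L'.d 1 0) (L.d 1 0) (ι.comm 1 0) ε' ε hισ hL.exact_zero
    fun n _ y _ => chainsMapAux_id_surjective ε' hL'.surjective n y
  { P := fun p => relChains f (ι.f p)
    d := fun p => relChainsMap (L'.d (p + 1) p) (L.d (p + 1) p) (ι.comm (p + 1) p)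
    ε := relChainsMap ε' ε hισ
    d_d := fun p => (succ p).choose
    d_ε := zero.choose
    exact_succ := fun p => (succ p).choose_spec
    exact_zero := zero.choose_spec
    epi_ε := by
      have (n : ℕ) : Epi ((relChainsMap ε' ε hισ).f n) :=
        (ModuleCat.epi_iff_surjective _).2 (relChainsMap_f_surjective ε' ε hισ hL.surjective n)
      exact HomologicalComplex.epi_of_epi_f _ this }

end RelativeGroupHomology

end

open RelativeGroupHomology in
theorem proposition7p1 {G : Type u} [Group G] (G' : Subgroup G)
    (L : ChainComplex (Rep.{v} ℤ G) ℕ) (M : Rep.{v} ℤ G) (ε : L.X 0 ⟶ M)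
    (hL : IsExactOver L ε)
    (L' : ChainComplex (Rep.{v} ℤ G') ℕ) (M' : Rep.{v} ℤ G') (ε' : L'.X 0 ⟶ M')
    (hL' : IsExactOver L' ε')
    (ι : L' ⟶ ((Rep.resFunctor G'.subtype).mapHomologicalComplex _).obj L)
    (hι : ∀ p, Function.Injective (ι.f p).hom)
    (σ : M' ⟶ Rep.res G'.subtype M) (hσ : Function.Injective σ.hom)
    (hισ : ι.f 0 ≫ (Rep.resFunctor G'.subtype).map ε = ε' ≫ σ) :
    ∃ (E : FirstQuadrantSpectralSequence.{max u v} ℤ)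
      (e : ∀ p q : ℕ, E.firstPage.X (p, q) ≅ relHomology G'.subtype (ι.f p) q),
      (∀ p q : ℕ, E.firstPage.d (p + 1, q) (p, q) ≫ (e p q).hom =
        (e (p + 1) q).hom ≫
          relHomologyMap (L'.d (p + 1) p) (L.d (p + 1) p) (ι.comm (p + 1) p) q) ∧
      E.ConvergesTo (fun n => relHomology G'.subtype σ n) :=
  (relChainsResolution G'.subtype_injective hL hL' ι hι σ hσ hισ).exists_spectralSequence
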